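/- Let $d,n,k$ be integers with $n\ge 1$ and $0\le k\le n$. Let $|\Psi\rangle\in\mathrm{Sym}^n(\mathbb C^d)\subset(\mathbb C^d)^{\otimes n}$ be a unit vector, where $\mathrm{Sym}^n(\mathbb C^d)$ is the subspace of vectors fixed by all permutations of the $n$ tensor factors, and let $\xi^k:=\mathrm{tr}_{n-k}|\Psi\rangle\langle\Psi|$ be the state on $(\mathbb C^d)^{\otimes k}$ obtained by tracing out the last $n-k$ systems. Write $\|A\|:=\tfrac12\,\mathrm{tr}|A|$, $|A|=\sqrt{A^\dagger A}$, and let $\mathcal P_{(k)}(\mathbb C^d)$ be the set of operators $\int |v^g\rangle\langle v^g|\,dm(g)$, where $m$ is a probability measure on the unitary group $\mathsf U(d)$, $v^g:=g^{\otimes k}v$, and $v$ is the normalised highest weight vector (weight $(k,0,\dots,0)$, unique up to a phase) of the representation $g\mapsto g^{\otimes k}$ of $\mathsf U(d)$ on $\mathrm{Sym}^k(\mathbb C^d)$. Then $\xi^k$ is $\varepsilon$-close to $\mathcal P_{(k)}(\mathbb C^d)$ for $\varepsilon:=2\frac{dk}{n}$, i.e. there is $\sigma\in\mathcal P_{(k)}(\mathbb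 C^d)$ with \[ \|\xi^k-\sigma\|\le 2\frac{dk}{n}. \] Equivalently, there is a (Borel) probability measure $m$ on the pure states (unit vectors) $|\varphi\rangle$ of $\mathbb C^d$ such that \[ \Bigl\|\xi^k-\int|\varphi\rangle\langle\varphi|^{\otimes k}\,dm(\varphi)\Bigr\|\le 2\frac{dk}{n}. \] -/

import Mathlib

open MeasureTheory
open scoped Matrix

noncomputable section

namespace QuantumDeFinetti

/-- The Hilbert space `(ℂ^d)^{⊗n}`, in the orthonormal product basis: a vector is the family of
its coefficients `⟨x₁ ⋯ xₙ|Ψ⟩`, indexed by `x : Fin n → Fin d`. For the single-system space `ℂ^d`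
itself we use `EuclideanSpace ℂ (Fin d)`. -/
abbrev TensorSpace (d n : ℕ) : Type := EuclideanSpace ℂ (Fin n → Fin d)

/-- Operators on `(ℂ^d)^{⊗n}`, as matrices in the product basis. -/
abbrev TensorOp (d n : ℕ) : Type := Matrix (Fin n → Fin d) (Fin n → Fin d) ℂ

/-- The symmetric subspace `Sym^n(ℂ^d)`: the vectors of `(ℂ^d)^{⊗n}` fixed by every permutation
of the `n` tensor factors. -/
def symSubspace (d n : ℕ) : Submodule ℂ (TensorSpace d n) where
  carrier := {Ψ | ∀ (π : Equiv.Perm (Fin n)) (x : Fin n → Fin d), Ψ (x ∘ π) = Ψ x}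
  zero_mem' := fun _ _ => rfl
  add_mem' := fun {a b} ha hb π x => by
    simp only [PiLp.add_apply, ha π x, hb π x]
  smul_mem' := fun c a ha π x => by
    simp only [PiLp.smul_apply, ha π x]

/-- The rank-one operator `|v⟩⟨v|`. -/
def ketBra {ι : Type*} (v : EuclideanSpace ℂ ι) : Matrix ι ι ℂ :=
  Matrix.vecMulVec (fun i => v i) (fun i => star (v i))

/-- The `k`-fold tensor power `A^{⊗k}` of an operator `A` on `ℂ^d`. -/
def tensorPower {d : ℕ} (k : ℕ) (A : Matrix (Fin d) (Fin d) ℂ) : TensorOp d k :=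
  Matrix.of fun x y => ∏ i, A (x i) (y i)

/-- The partial trace over the last `m` of `n = k + m` systems. -/
def partialTrace {d k m n : ℕ} (h : k + m = n) (ρ : TensorOp d n) : TensorOp d k :=
  Matrix.of fun x y => ∑ z : Fin m → Fin d,
    ρ (Fin.append x z ∘ Fin.cast h.symm) (Fin.append y z ∘ Fin.cast h.symm)

open scoped MatrixOrder Matrix.Norms.L2Operator in
/-- The trace norm `‖A‖ = ½ tr |A|`, with `|A| = √(A* A)`. The distance it induces is the trace
distance. -/
def traceNorm {ι : Type*} [Fintype ι] [DecidableEq ι] (A : Matrix ι ι ℂ) : ℝ :=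
  (1 / 2) * (Matrix.trace (CFC.abs A)).re

/-- The action `U_{(k)}(g) = g^{⊗k}` of the unitary group `U(d)` on vectors of `(ℂ^d)^{⊗k}`. It
leaves `Sym^k(ℂ^d)` invariant, and there it is the irreducible representation `U_{(k)}` with
highest weight `(k, 0, …, 0)`. -/
def symRep {d : ℕ} (k : ℕ) (g : Matrix.unitaryGroup (Fin d) ℂ) (v : TensorSpace d k) :
    TensorSpace d k :=
  WithLp.toLp 2 (tensorPower k (g : Matrix (Fin d) (Fin d) ℂ) *ᵥ fun x => v x)

/-- `v` is a weight vector of weight `lam`: every diagonal unitary `h = diag(h₁, …, h_d)` acts on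
it as multiplication by `∏ hᵢ ^ lamᵢ`. -/
def IsWeightVector {d k : ℕ} (lam : Fin d → ℤ) (v : TensorSpace d k) : Prop :=
  v ≠ 0 ∧ ∀ (h : Matrix.unitaryGroup (Fin d) ℂ) (t : Fin d → ℂ),
    (h : Matrix (Fin d) (Fin d) ℂ) = Matrix.diagonal t →
      symRep k h v = (∏ i, t i ^ lam i) • v

/-- The weight `(k, 0, …, 0)`. -/
def rowWeight (d k : ℕ) : Fin d → ℤ := fun i => if (i : ℕ) = 0 then (k : ℤ) else 0

/-- `v` is a normalised highest weight vector of the representation `U_{(k)}` on `Sym^k(ℂ^d)`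
(it is unique up to a phase). -/
def IsHighestWeightVector {d k : ℕ} (v : TensorSpace d k) : Prop :=
  v ∈ symSubspace d k ∧ ‖v‖ = 1 ∧ IsWeightVector (rowWeight d k) v

/-- The Borel σ-algebra on the unitary group `U(d)`. -/
instance unitaryMeasurableSpace (d : ℕ) : MeasurableSpace (Matrix.unitaryGroup (Fin d) ℂ) :=
  borel _

instance unitaryBorelSpace (d : ℕ) : BorelSpace (Matrix.unitaryGroup (Fin d) ℂ) :=
  ⟨rfl⟩

/-- The operator `∫ |v^g⟩⟨v^g| dm(g)`, where `v^g = U_{(k)}(g) v`, as an entrywise integral. -/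
def coherentMixture {d k : ℕ} (v : TensorSpace d k)
    (m : Measure (Matrix.unitaryGroup (Fin d) ℂ)) : TensorOp d k :=
  Matrix.of fun x y => ∫ g, ketBra (symRep k g v) x y ∂m

/-- The set `𝒫_{(k)}(ℂ^d)` of states `∫ |v^g⟩⟨v^g| dm(g)`, where `v` is the highest weight vector of
`U_{(k)}` and `m` is a probability measure on `U(d)`. -/
def coherentStates (d k : ℕ) : Set (TensorOp d k) :=
  {σ | ∃ v : TensorSpace d k, IsHighestWeightVector v ∧
    ∃ m : Measure (Matrix.unitaryGroup (Fin d) ℂ), IsProbabilityMeasure m ∧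
      σ = coherentMixture v m}

/-- The pure states on `ℂ^d`, given by unit vectors. -/
abbrev PureState (d : ℕ) : Type := Metric.sphere (0 : EuclideanSpace ℂ (Fin d)) 1

/-- The operator `∫ |φ⟩⟨φ|^{⊗k} dm(φ)`, as an entrywise integral. -/
def productMixture {d : ℕ} (k : ℕ) (m : Measure (PureState d)) : TensorOp d k :=
  Matrix.of fun x y =>
    ∫ φ : PureState d, tensorPower k (ketBra (φ : EuclideanSpace ℂ (Fin d))) x y ∂m

end QuantumDeFinetti

end

/-! Let `m = n - k` and let z be a standard complex Gaussian vector. Its moments satisfy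
E[z^{⊗n}(z^{⊗n})†] = n! P_sym, so z^{⊗n} behaves like a coherent-state measurement on Sym^n. The
approximating measure is the law of the direction u of z after reweighting by |⟨z^{⊗n}|Ψ⟩|²/n!; let
σ be its product mixture. For a test vector w on k systems put Ψ_w = (⟨w| ⊗ 1)Ψ, a symmetric vector
with ‖Ψ_w‖² = ⟨w|ξ|w⟩. Expanding E|A - B|² ≥ 0 for A = ‖z‖^k ⟨z^{⊗m}|Ψ_w⟩ and B = conj⟨u^{⊗k}|w⟩
⟨z^{⊗n}|Ψ⟩ gives (`quadratic_form_nonneg`) the operator inequality (1 - 2r)ξ + rσ ≥ 0, where r = dim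
Sym^m / dim Sym^n. Consequently ξ - σ is a difference of two positive operators of trace 2(1 - r)
each, so its trace distance is at most 2(1 - r) (`traceNorm_sub_le`), and 1 - r ≤ dk/n
(`dimension_ratio_bounds`). Finally, a measurable choice of unitaries carrying the first basis
vector to u, up to phase, exhibits σ as an element of `coherentStates`
(`productMixture_mem_coherentStates`). -/

noncomputable section

namespace QuantumDeFinetti

open scoped Nat ComplexOrder

/-! ### Moments of one complex Gaussian variable -/

/-- The exponential weight `e^{-r} dr` on `(0, ∞)`. -/
def expWeight : Measure ℝ :=
  (volume.restrict (Set.Ioi 0)).withDensity fun r => ENNReal.ofReal (Real.exp (-r))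

instance : SFinite expWeight := by unfold expWeight; infer_instance

lemma integrable_sqrt_pow_expWeight (p : ℕ) :
    Integrable (fun r : ℝ => ((Real.sqrt r : ℝ) : ℂ) ^ p) expWeight := by
  have h : Integrable (fun r : ℝ => Real.sqrt r ^ p) expWeight := by
    unfold expWeight
    rw [integrable_withDensity_iff_integrable_smul' (by fun_prop) (by simp)]
    have := Real.GammaIntegral_convergent (s := (p : ℝ) / 2 + 1) (by positivity)
    refine (integrableOn_congr_fun (fun r hr => ?_) measurableSet_Ioi).1 this
    rw [ENNReal.toReal_ofReal (Real.exp_pos _).le, smul_eq_mul, Real.sqrt_eq_rpow,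
      ← Real.rpow_natCast, ← Real.rpow_mul (le_of_lt hr)]
    congr 2
    ring
  simpa using h.ofReal (𝕜 := ℂ)

lemma integral_sqrt_pow_expWeight (a : ℕ) :
    ∫ r, ((Real.sqrt r : ℝ) : ℂ) ^ (2 * a) ∂expWeight = a ! := by
  have h : ∫ r, Real.sqrt r ^ (2 * a) ∂expWeight = a ! := by
    unfold expWeight
    rw [integral_withDensity_eq_integral_toReal_smul (by fun_prop) (by simp),
      ← Real.Gamma_nat_eq_factorial, Real.Gamma_eq_integral (by positivity)]
    refine setIntegral_congr_fun measurableSet_Ioi fun r hr => ?_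
    have hr' : 0 ≤ r := le_of_lt hr
    simp [ENNReal.toReal_ofReal (Real.exp_pos _).le, pow_mul, Real.sq_sqrt hr']
  rw [← Complex.ofReal_natCast, ← h, ← integral_complex_ofReal]
  simp

lemma integral_fourier_haarAddCircle (n : ℤ) :
    ∫ θ : AddCircle (1 : ℝ), fourier n θ ∂AddCircle.haarAddCircle = if n = 0 then 1 else 0 := by
  split_ifs with h
  · simp [h]
  · exact integral_eq_zero_of_add_right_eq_neg (μ := AddCircle.haarAddCircle)
      (fourier_add_half_inv_index h one_pos)

/-- The standard complex Gaussian law: the law of `√r e^{2πiθ}`, with `r` exponential and `θ`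
uniform. -/
def complexGaussian : Measure ℂ :=
  (expWeight.prod (AddCircle.haarAddCircle (T := (1 : ℝ)))).map
    fun p => ((Real.sqrt p.1 : ℝ) : ℂ) * fourier 1 p.2

lemma measurable_polar :
    Measurable fun p : ℝ × AddCircle (1 : ℝ) => ((Real.sqrt p.1 : ℝ) : ℂ) * fourier 1 p.2 := by
  have : Measurable (fourier 1 : AddCircle (1 : ℝ) → ℂ) := (fourier 1).continuous.measurable
  fun_prop

lemma fourier_one_pow_mul (θ : AddCircle (1 : ℝ)) (a b : ℕ) :
    (fourier 1 θ) ^ a * star (fourier 1 θ) ^ b = fourier ((a : ℤ) - b) θ := by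
  have h1 : ∀ n : ℕ, fourier (n : ℤ) θ = (fourier 1 θ) ^ n := by
    intro n
    induction n with
    | zero => simp
    | succ n ih => rw [Nat.cast_succ, fourier_add, ih, pow_succ]
  rw [sub_eq_add_neg, fourier_add, fourier_neg, h1, h1, map_pow]
  rfl

lemma polar_monomial (a b : ℕ) (p : ℝ × AddCircle (1 : ℝ)) :
    (((Real.sqrt p.1 : ℝ) : ℂ) * fourier 1 p.2) ^ a *
        star (((Real.sqrt p.1 : ℝ) : ℂ) * fourier 1 p.2) ^ b =
      ((Real.sqrt p.1 : ℝ) : ℂ) ^ (a + b) * fourier ((a : ℤ) - b) p.2 := by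
  rw [← fourier_one_pow_mul, star_mul', mul_pow, mul_pow, pow_add]
  have : star ((Real.sqrt p.1 : ℝ) : ℂ) = ((Real.sqrt p.1 : ℝ) : ℂ) := Complex.conj_ofReal _
  rw [this]
  ring

lemma integrable_monomial_complexGaussian (a b : ℕ) :
    Integrable (fun z : ℂ => z ^ a * star z ^ b) complexGaussian := by
  unfold complexGaussian
  rw [integrable_map_measure (by fun_prop) measurable_polar.aemeasurable]
  simp only [Function.comp_def, polar_monomial]
  refine (integrable_sqrt_pow_expWeight (a + b)).mul_prod ?_
  exact (fourier ((a : ℤ) - b)).continuous.integrable_of_hasCompactSupport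
    (HasCompactSupport.of_compactSpace _)

/-- In polar form the uniform phase kills every monomial with a ≠ b, and the radial factor is the
Gamma integral of r^a e^{-r}. -/
lemma integral_monomial_complexGaussian (a b : ℕ) :
    ∫ z : ℂ, z ^ a * star z ^ b ∂complexGaussian = if a = b then (a ! : ℂ) else 0 := by
  unfold complexGaussian
  rw [integral_map measurable_polar.aemeasurable (by fun_prop)]
  simp only [polar_monomial]
  rw [integral_prod_mul (fun r : ℝ => ((Real.sqrt r : ℝ) : ℂ) ^ (a + b)),
    integral_fourier_haarAddCircle]
  by_cases h : a = b
  · subst h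
    simp [← two_mul, integral_sqrt_pow_expWeight]
  · simp [h, sub_eq_zero]

instance : IsFiniteMeasure complexGaussian := by
  have := integrable_monomial_complexGaussian 0 0
  simp only [pow_zero, mul_one] at this
  exact (integrable_const_iff_isFiniteMeasure one_ne_zero).1 this

/-! ### Gaussian moments of tensor powers and the symmetric projector -/

/-- The standard Gaussian law on `ℂ^d`. -/
def gaussianVec (d : ℕ) : Measure (Fin d → ℂ) := Measure.pi fun _ => complexGaussian

/-- The coefficient `⟨x|z^{⊗n}⟩ = ∏ᵢ z (x i)` of a tensor power. -/
def tensorCoeff {d n : ℕ} (z : Fin d → ℂ) (x : Fin n → Fin d) : ℂ := ∏ i, z (x i)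

/-- The number of occurrences of `j` in `x`. -/
def typeCount {d n : ℕ} (x : Fin n → Fin d) (j : Fin d) : ℕ := Fintype.card {i // x i = j}

/-- The moments `E[z^{⊗n} (z^{⊗m})^†]` of the standard Gaussian law. -/
def momentKernel {d n m : ℕ} (x : Fin n → Fin d) (y : Fin m → Fin d) : ℂ :=
  ∏ j, if typeCount x j = typeCount y j then ((typeCount x j)! : ℂ) else 0

lemma tensorCoeff_eq_prod_pow {d n : ℕ} (z : Fin d → ℂ) (x : Fin n → Fin d) :
    tensorCoeff z x = ∏ j, z j ^ typeCount x j := by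
  unfold tensorCoeff typeCount
  rw [← Finset.prod_fiberwise_of_maps_to (g := x) (t := Finset.univ) (fun _ _ => Finset.mem_univ _)]
  refine Finset.prod_congr rfl fun j _ => ?_
  rw [Finset.prod_congr rfl (g := fun _ => z j) (by simp +contextual), Finset.prod_const,
    Fintype.card_subtype]

lemma tensorCoeff_mul_star {d n m : ℕ} (z : Fin d → ℂ) (x : Fin n → Fin d) (y : Fin m → Fin d) :
    tensorCoeff z x * star (tensorCoeff z y) =
      ∏ j, (z j ^ typeCount x j * star (z j) ^ typeCount y j) := by
  rw [tensorCoeff_eq_prod_pow, tensorCoeff_eq_prod_pow, star_prod, Finset.prod_mul_distrib]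
  simp

lemma integrable_tensorCoeff_mul_star {d n m : ℕ} (x : Fin n → Fin d) (y : Fin m → Fin d) :
    Integrable (fun z => tensorCoeff z x * star (tensorCoeff z y)) (gaussianVec d) := by
  simp only [tensorCoeff_mul_star]
  exact Integrable.fintype_prod (f := fun j (c : ℂ) => c ^ typeCount x j * star c ^ typeCount y j)
    fun j => integrable_monomial_complexGaussian _ _

lemma integral_tensorCoeff_mul_star {d n m : ℕ} (x : Fin n → Fin d) (y : Fin m → Fin d) :
    ∫ z, tensorCoeff z x * star (tensorCoeff z y) ∂gaussianVec d = momentKernel x y := by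
  simp only [tensorCoeff_mul_star]
  unfold gaussianVec momentKernel
  rw [integral_fintype_prod_eq_prod (fun j (c : ℂ) => c ^ typeCount x j * star c ^ typeCount y j)]
  simp only [integral_monomial_complexGaussian]

lemma typeCount_comp_perm {d n : ℕ} (x : Fin n → Fin d) (π : Equiv.Perm (Fin n)) (j : Fin d) :
    typeCount (x ∘ π) j = typeCount x j :=
  Fintype.card_congr (π.subtypeEquiv fun _ => Iff.rfl)

lemma exists_perm_of_typeCount_eq {d n : ℕ} {x y : Fin n → Fin d}
    (h : ∀ j, typeCount x j = typeCount y j) : ∃ π : Equiv.Perm (Fin n), x ∘ π = y := by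
  have e : ∀ j, {i // y i = j} ≃ {i // x i = j} := fun j =>
    Fintype.equivOfCardEq (h j).symm
  refine ⟨(Equiv.sigmaFiberEquiv y).symm.trans
    ((Equiv.sigmaCongrRight e).trans (Equiv.sigmaFiberEquiv x)), funext fun i => ?_⟩
  exact (e (y i) ⟨i, rfl⟩).2

/-- The permutations carrying x to y are either absent, when the types differ, or a coset of the
stabilizer of x, whose order is the product of the factorials of the counts. -/
lemma momentKernel_eq_card {d n : ℕ} (x y : Fin n → Fin d) :
    momentKernel x y = ∑ π : Equiv.Perm (Fin n), if x ∘ π = y then (1 : ℂ) else 0 := by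
  unfold momentKernel
  by_cases h : ∀ j, typeCount x j = typeCount y j
  · obtain ⟨τ, rfl⟩ := exists_perm_of_typeCount_eq h
    simp only [typeCount_comp_perm, if_true]
    have hs := DomMulAct.stabilizer_card x
    rw [← Equiv.sum_comp (Equiv.mulRight τ)]
    have h2 : ∀ π : Equiv.Perm (Fin n), (x ∘ ⇑((Equiv.mulRight τ) π) = x ∘ τ) ↔ x ∘ π = x := by
      intro π
      rw [Equiv.coe_mulRight, Equiv.Perm.coe_mul, ← Function.comp_assoc]
      exact τ.surjective.injective_comp_right.eq_iff
    simp only [h2]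
    rw [Finset.sum_boole, ← Fintype.card_subtype, hs]
    simp [typeCount]
  · rw [Finset.sum_eq_zero]
    · push Not at h
      obtain ⟨j, hj⟩ := h
      exact Finset.prod_eq_zero (Finset.mem_univ j) (if_neg hj)
    · rintro π -
      refine if_neg ?_
      rintro rfl
      exact h fun j => (typeCount_comp_perm x π j).symm

/-- The kernel is a sum of permutation operators, and each of the n! summands fixes a symmetric
vector. -/
lemma sum_momentKernel_mul {d n : ℕ} (x : Fin n → Fin d) (Ψ : (Fin n → Fin d) → ℂ)
    (hΨ : ∀ (π : Equiv.Perm (Fin n)) (x : Fin n → Fin d), Ψ (x ∘ π) = Ψ x) :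
    ∑ y, momentKernel x y * Ψ y = n ! * Ψ x := by
  simp only [momentKernel_eq_card, Finset.sum_mul]
  rw [Finset.sum_comm]
  simp [hΨ, Fintype.card_perm]

lemma typeCount_cons {d n : ℕ} (a : Fin d) (x : Fin n → Fin d) (j : Fin d) :
    typeCount (Fin.cons a x : Fin (n + 1) → Fin d) j =
      typeCount x j + if a = j then 1 else 0 := by
  unfold typeCount
  rw [Fintype.card_subtype, Fintype.card_subtype, Finset.card_filter, Finset.card_filter,
    Fin.sum_univ_succ]
  simp [add_comm]

lemma sum_typeCount {d n : ℕ} (x : Fin n → Fin d) : ∑ j, typeCount x j = n := by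
  unfold typeCount
  simp only [Fintype.card_subtype]
  rw [← Finset.card_eq_sum_card_fiberwise (f := x) (s := Finset.univ) (by simp)]
  simp

/-- Prepending the letter a to both words multiplies the kernel by count(a) + 1, and these factors
sum to n + d. This is the partial trace of one factor that evaluates moments weighted by ‖z‖². -/
lemma sum_momentKernel_cons {d n : ℕ} (x y : Fin n → Fin d) :
    ∑ a : Fin d, momentKernel (Fin.cons a x : Fin (n + 1) → Fin d)
      (Fin.cons a y : Fin (n + 1) → Fin d) = (d + n : ℕ) * momentKernel x y := by
  have h : ∀ a : Fin d, momentKernel (Fin.cons a x : Fin (n + 1) → Fin d)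
      (Fin.cons a y : Fin (n + 1) → Fin d) = (typeCount x a + 1 : ℕ) * momentKernel x y := by
    intro a
    unfold momentKernel
    have : ((typeCount x a + 1 : ℕ) : ℂ) = ∏ j, if a = j then ((typeCount x j + 1 : ℕ) : ℂ) else 1 := by
      simp
    rw [this, ← Finset.prod_mul_distrib]
    refine Finset.prod_congr rfl fun j _ => ?_
    rw [typeCount_cons, typeCount_cons]
    by_cases haj : a = j
    · simp [haj, Nat.factorial_succ]
    · simp [haj]
  simp only [h]
  rw [← Finset.sum_mul, ← Nat.cast_sum, Finset.sum_add_distrib, sum_typeCount]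
  simp [add_comm]

/-! ### Moments weighted by powers of the norm -/

/-- The squared norm of `z`, as a complex number. -/
def sqNorm {d : ℕ} (z : Fin d → ℂ) : ℂ := ∑ j, z j * star (z j)

lemma sqNorm_mul_tensorCoeff {d n : ℕ} (z : Fin d → ℂ) (x y : Fin n → Fin d) :
    sqNorm z * (tensorCoeff z x * star (tensorCoeff z y)) =
      ∑ a, tensorCoeff z (Fin.cons a x : Fin (n + 1) → Fin d) *
        star (tensorCoeff z (Fin.cons a y : Fin (n + 1) → Fin d)) := by
  unfold sqNorm tensorCoeff
  rw [Finset.sum_mul]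
  refine Finset.sum_congr rfl fun a _ => ?_
  simp [Fin.prod_univ_succ]
  ring

lemma integrable_sqNorm_pow_mul {d n : ℕ} (k : ℕ) (x y : Fin n → Fin d) :
    Integrable (fun z => sqNorm z ^ k * (tensorCoeff z x * star (tensorCoeff z y)))
      (gaussianVec d) := by
  induction k generalizing n with
  | zero => simpa using integrable_tensorCoeff_mul_star x y
  | succ k ih =>
    simp only [pow_succ, mul_assoc, sqNorm_mul_tensorCoeff, Finset.mul_sum]
    exact integrable_finsetSum _ fun a _ => ih _ _

/-- Each factor ‖z‖² is traded for one extra tensor factor that is traced out, so the induction on k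
moves from n to n + 1 and collects the factor d + n. -/
lemma integral_sqNorm_pow_mul {d n : ℕ} (k : ℕ) (x y : Fin n → Fin d) :
    ∫ z, sqNorm z ^ k * (tensorCoeff z x * star (tensorCoeff z y)) ∂gaussianVec d =
      ((d + n).ascFactorial k : ℕ) * momentKernel x y := by
  induction k generalizing n with
  | zero => simpa using integral_tensorCoeff_mul_star x y
  | succ k ih =>
    simp only [pow_succ, mul_assoc, sqNorm_mul_tensorCoeff, Finset.mul_sum]
    rw [integral_finsetSum _ fun a _ => integrable_sqNorm_pow_mul k _ _]
    simp only [ih]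
    rw [← Finset.mul_sum, sum_momentKernel_cons, ← mul_assoc, ← Nat.cast_mul, mul_comm _ (d + n),
      ← add_assoc d n 1, ← Nat.succ_eq_add_one, Nat.succ_ascFactorial, Nat.ascFactorial_succ]

/-- The inner product `⟨z^{⊗n}|a⟩`. -/
def powerPairing {d n : ℕ} (z : Fin d → ℂ) (a : (Fin n → Fin d) → ℂ) : ℂ :=
  ∑ x, star (tensorCoeff z x) * a x

lemma continuous_tensorCoeff {d n : ℕ} (x : Fin n → Fin d) :
    Continuous fun z : Fin d → ℂ => tensorCoeff z x := by
  unfold tensorCoeff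
  fun_prop

lemma continuous_powerPairing {d n : ℕ} (a : (Fin n → Fin d) → ℂ) :
    Continuous fun z : Fin d → ℂ => powerPairing z a := by
  unfold powerPairing
  have := @continuous_tensorCoeff d n
  fun_prop

lemma sqNorm_pow_mul_powerPairing {d n : ℕ} (k : ℕ) (z : Fin d → ℂ)
    (a b : (Fin n → Fin d) → ℂ) :
    sqNorm z ^ k * (star (powerPairing z a) * powerPairing z b) =
      ∑ x, ∑ y, star (a x) * b y *
        (sqNorm z ^ k * (tensorCoeff z x * star (tensorCoeff z y))) := by
  unfold powerPairing
  rw [star_sum, Finset.sum_mul_sum, Finset.mul_sum]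
  refine Finset.sum_congr rfl fun x _ => ?_
  rw [Finset.mul_sum]
  refine Finset.sum_congr rfl fun y _ => ?_
  simp only [star_mul', star_star]
  ring

lemma integrable_powerPairing {d n : ℕ} (k : ℕ) (a b : (Fin n → Fin d) → ℂ) :
    Integrable (fun z => sqNorm z ^ k * (star (powerPairing z a) * powerPairing z b))
      (gaussianVec d) := by
  simp only [sqNorm_pow_mul_powerPairing]
  exact integrable_finsetSum _ fun x _ => integrable_finsetSum _ fun y _ =>
    (integrable_sqNorm_pow_mul k x y).const_mul _

/-- Symmetry is required of b alone: the symmetric projector fixes b, and a may be arbitrary. The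
cross term below relies on this. -/
lemma integral_powerPairing {d n : ℕ} (k : ℕ) (a b : (Fin n → Fin d) → ℂ)
    (hb : ∀ (π : Equiv.Perm (Fin n)) (x : Fin n → Fin d), b (x ∘ π) = b x) :
    ∫ z, sqNorm z ^ k * (star (powerPairing z a) * powerPairing z b) ∂gaussianVec d =
      ((d + n).ascFactorial k : ℕ) * n ! * ∑ x, star (a x) * b x := by
  simp only [sqNorm_pow_mul_powerPairing]
  rw [integral_finsetSum _ fun x _ => integrable_finsetSum _ fun y _ =>
    (integrable_sqNorm_pow_mul k x y).const_mul _, Finset.mul_sum]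
  refine Finset.sum_congr rfl fun x _ => ?_
  rw [integral_finsetSum _ fun y _ => (integrable_sqNorm_pow_mul k x y).const_mul _]
  simp only [integral_const_mul, integral_sqNorm_pow_mul]
  calc _ = ((d + n).ascFactorial k : ℂ) * (star (a x) * ∑ y, momentKernel x y * b y) := by
        simp only [Finset.mul_sum]
        refine Finset.sum_congr rfl fun y _ => ?_
        ring
    _ = _ := by
        rw [sum_momentKernel_mul x b hb]
        ring

/-! ### Directions of Gaussian vectors and the de Finetti measure -/

/-- The direction of `z`, with a default value at `z = 0`. -/
def direction {d : ℕ} (e : PureState d) (z : Fin d → ℂ) : PureState d :=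
  if h : z = 0 then e else
    ⟨((‖WithLp.toLp 2 z‖⁻¹ : ℝ) : ℂ) • WithLp.toLp 2 z, by
      have : ‖WithLp.toLp 2 z‖ ≠ 0 := by simpa using h
      simp [norm_smul, this]⟩

lemma norm_smul_direction {d : ℕ} (e : PureState d) (z : Fin d → ℂ) (j : Fin d) :
    z j = (‖WithLp.toLp 2 z‖ : ℂ) * (direction e z : EuclideanSpace ℂ (Fin d)) j := by
  unfold direction
  split_ifs with h
  · simp [h]
  · have : (‖WithLp.toLp 2 z‖ : ℂ) ≠ 0 := by simpa using h
    simp [this]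

lemma measurable_direction {d : ℕ} (e : PureState d) : Measurable (direction e) := by
  have h : ∀ z, (direction e z : EuclideanSpace ℂ (Fin d)) =
      if z = 0 then (e : EuclideanSpace ℂ (Fin d)) else
        ((‖WithLp.toLp 2 z‖⁻¹ : ℝ) : ℂ) • WithLp.toLp 2 z := by
    intro z
    unfold direction
    split_ifs <;> rfl
  refine Measurable.subtype_mk (f := fun z => (direction e z : EuclideanSpace ℂ (Fin d)))
    (h := fun z => (direction e z).2) ?_
  simp only [h]
  exact Measurable.ite (measurableSet_singleton 0) measurable_const (by fun_prop)

lemma sqNorm_eq {d : ℕ} (z : Fin d → ℂ) : sqNorm z = (‖WithLp.toLp 2 z‖ : ℂ) ^ 2 := by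
  rw [← Complex.ofReal_pow, EuclideanSpace.norm_sq_eq, Complex.ofReal_sum]
  unfold sqNorm
  refine Finset.sum_congr rfl fun j _ => ?_
  simp [Complex.mul_conj']

lemma powerPairing_direction {d n : ℕ} (e : PureState d) (z : Fin d → ℂ)
    (a : (Fin n → Fin d) → ℂ) :
    powerPairing z a =
      (‖WithLp.toLp 2 z‖ : ℂ) ^ n *
        powerPairing (fun j => (direction e z : EuclideanSpace ℂ (Fin d)) j) a := by
  unfold powerPairing
  rw [Finset.mul_sum]
  refine Finset.sum_congr rfl fun x _ => ?_
  rw [← mul_assoc]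
  congr 1
  unfold tensorCoeff
  rw [Finset.prod_congr rfl fun i _ => norm_smul_direction e z (x i), Finset.prod_mul_distrib]
  simp

/-- The law of the direction of `z` under the Gaussian law reweighted by `|⟨z^{⊗n}|Ψ⟩|² / n!`. -/
def deFinettiMeasure {d n : ℕ} (e : PureState d) (Ψ : (Fin n → Fin d) → ℂ) :
    Measure (PureState d) :=
  ((gaussianVec d).withDensity fun z =>
    ENNReal.ofReal (‖powerPairing z Ψ‖ ^ 2 / n !)).map (direction e)

lemma integrable_mul_direction {d n : ℕ} (e : PureState d) (Ψ : (Fin n → Fin d) → ℂ)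
    {h : PureState d → ℂ} (hh : Continuous h) :
    Integrable (fun z => star (powerPairing z Ψ) * powerPairing z Ψ * h (direction e z))
      (gaussianVec d) := by
  obtain ⟨C, hC⟩ := (isCompact_range hh).isBounded.exists_norm_le
  have h0 := integrable_powerPairing 0 Ψ Ψ
  simp only [pow_zero, one_mul] at h0
  refine Integrable.mul_bdd (c := C) h0
    (hh.measurable.comp (measurable_direction e)).aestronglyMeasurable
    (Filter.Eventually.of_forall fun z => hC _ (Set.mem_range_self _))

lemma integral_deFinettiMeasure {d n : ℕ} (e : PureState d) (Ψ : (Fin n → Fin d) → ℂ)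
    {h : PureState d → ℂ} (hh : Continuous h) :
    ∫ z, star (powerPairing z Ψ) * powerPairing z Ψ * h (direction e z) ∂gaussianVec d =
      n ! * ∫ u, h u ∂deFinettiMeasure e Ψ := by
  have hm := continuous_powerPairing (d := d) Ψ
  unfold deFinettiMeasure
  rw [integral_map (measurable_direction e).aemeasurable hh.aestronglyMeasurable,
    integral_withDensity_eq_integral_toReal_smul
      (by exact (ENNReal.continuous_ofReal.comp (by fun_prop)).measurable) (by simp),
    ← integral_const_mul]
  refine integral_congr_ae (Filter.Eventually.of_forall fun z => ?_)
  have hf : (n ! : ℂ) ≠ 0 := by exact_mod_cast n.factorial_ne_zero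
  simp only
  rw [ENNReal.toReal_ofReal (by positivity), Complex.real_smul, Complex.ofReal_div,
    Complex.ofReal_natCast, Complex.ofReal_pow]
  have : star (powerPairing z Ψ) * powerPairing z Ψ = (‖powerPairing z Ψ‖ : ℂ) ^ 2 := by
    simpa using Complex.conj_mul' (powerPairing z Ψ)
  rw [this]
  field_simp

/-- The total mass is E|⟨z^{⊗n}|Ψ⟩|²/n!, which equals ‖Ψ‖² because Ψ is symmetric. -/
lemma isProbabilityMeasure_deFinettiMeasure {d n : ℕ} (e : PureState d)
    (Ψ : (Fin n → Fin d) → ℂ)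
    (hΨ : ∀ (π : Equiv.Perm (Fin n)) (x : Fin n → Fin d), Ψ (x ∘ π) = Ψ x)
    (h1 : ∑ x, star (Ψ x) * Ψ x = 1) :
    IsProbabilityMeasure (deFinettiMeasure e Ψ) := by
  have h := integral_deFinettiMeasure e Ψ (h := fun _ => 1) continuous_const
  have h2 := integral_powerPairing 0 Ψ Ψ hΨ
  simp only [pow_zero, one_mul, Nat.ascFactorial_zero, Nat.cast_one, h1, mul_one] at h h2
  have hf : (n ! : ℂ) ≠ 0 := by exact_mod_cast n.factorial_ne_zero
  rw [h2, integral_const] at h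
  have h3 : (deFinettiMeasure e Ψ).real Set.univ = 1 := by
    have : (n ! : ℂ) * 1 = n ! * (((deFinettiMeasure e Ψ).real Set.univ : ℝ) : ℂ) := by
      simpa using h
    exact_mod_cast (mul_left_cancel₀ hf this).symm
  exact ⟨by simpa [Measure.real, ENNReal.toReal_eq_one_iff] using h3⟩

/-! ### Contraction with a test vector and the key positivity -/

lemma sum_append {d k m : ℕ} {M : Type*} [AddCommMonoid M] (f : (Fin (k + m) → Fin d) → M) :
    ∑ x, f x = ∑ x : Fin k → Fin d, ∑ y : Fin m → Fin d, f (Fin.append x y) := by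
  rw [← Fintype.sum_prod_type', ← Equiv.sum_comp (Fin.appendEquiv k m)]
  rfl

lemma tensorCoeff_append {d k m : ℕ} (z : Fin d → ℂ) (x : Fin k → Fin d) (y : Fin m → Fin d) :
    tensorCoeff z (Fin.append x y) = tensorCoeff z x * tensorCoeff z y := by
  simp [tensorCoeff, Fin.prod_univ_add]

/-- The partial inner product `(⟨w| ⊗ 1)|Ψ⟩`. -/
def contract {d k m : ℕ} (w : (Fin k → Fin d) → ℂ) (Ψ : (Fin (k + m) → Fin d) → ℂ) :
    (Fin m → Fin d) → ℂ := fun y => ∑ x, star (w x) * Ψ (Fin.append x y)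

lemma append_comp_perm {d k m : ℕ} (x : Fin k → Fin d) (y : Fin m → Fin d)
    (π : Equiv.Perm (Fin m)) : ∃ τ : Equiv.Perm (Fin (k + m)),
      Fin.append x (y ∘ π) = Fin.append x y ∘ τ := by
  refine ⟨finSumFinEquiv.symm.trans ((Equiv.sumCongr (Equiv.refl _) π).trans finSumFinEquiv), ?_⟩
  funext i
  refine Fin.addCases (fun i => ?_) (fun i => ?_) i <;> simp

lemma contract_comp_perm {d k m : ℕ} (w : (Fin k → Fin d) → ℂ) (Ψ : (Fin (k + m) → Fin d) → ℂ)
    (hΨ : ∀ (π : Equiv.Perm (Fin (k + m))) (x : Fin (k + m) → Fin d), Ψ (x ∘ π) = Ψ x)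
    (π : Equiv.Perm (Fin m)) (y : Fin m → Fin d) :
    contract w Ψ (y ∘ π) = contract w Ψ y := by
  unfold contract
  refine Finset.sum_congr rfl fun x _ => ?_
  obtain ⟨τ, hτ⟩ := append_comp_perm x y π
  rw [hτ, hΨ]

/-- The two conjugated pairings merge into the pairing with w ⊗ Ψ_w, where Ψ_w is `contract w Ψ`.
The moment formula then gives n!⟨w ⊗ Ψ_w|Ψ⟩ = n!‖Ψ_w‖². -/
lemma integral_cross_term {d k m : ℕ} (w : (Fin k → Fin d) → ℂ)
    (Ψ : (Fin (k + m) → Fin d) → ℂ)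
    (hΨ : ∀ (π : Equiv.Perm (Fin (k + m))) (x : Fin (k + m) → Fin d), Ψ (x ∘ π) = Ψ x) :
    Integrable (fun z => star (powerPairing z (contract w Ψ)) *
      (star (powerPairing z w) * powerPairing z Ψ)) (gaussianVec d) ∧
    ∫ z, star (powerPairing z (contract w Ψ)) *
      (star (powerPairing z w) * powerPairing z Ψ) ∂gaussianVec d =
      (k + m)! * ∑ y, star (contract w Ψ y) * contract w Ψ y := by
  set b : (Fin (k + m) → Fin d) → ℂ := fun x =>
    w (fun i => x (Fin.castAdd m i)) * contract w Ψ (fun i => x (Fin.natAdd k i)) with hb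
  have hbapp : ∀ x y, b (Fin.append x y) = w x * contract w Ψ y := by
    intro x y
    simp [hb]
  have h1 : ∀ z : Fin d → ℂ, star (powerPairing z (contract w Ψ)) *
      (star (powerPairing z w) * powerPairing z Ψ) =
      sqNorm z ^ 0 * (star (powerPairing z b) * powerPairing z Ψ) := by
    intro z
    have : powerPairing z b = powerPairing z w * powerPairing z (contract w Ψ) := by
      unfold powerPairing
      rw [sum_append, Finset.sum_mul_sum]
      refine Finset.sum_congr rfl fun x _ => Finset.sum_congr rfl fun y _ => ?_
      rw [hbapp, tensorCoeff_append, star_mul']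
      ring
    rw [this, star_mul']
    ring
  simp only [h1]
  refine ⟨integrable_powerPairing 0 b Ψ, ?_⟩
  rw [integral_powerPairing 0 b Ψ hΨ, sum_append]
  simp only [Nat.ascFactorial_zero, Nat.cast_one, one_mul, hbapp]
  rw [Finset.sum_comm]
  congr 1
  refine Finset.sum_congr rfl fun y _ => ?_
  nth_rw 3 [contract]
  rw [Finset.mul_sum]
  refine Finset.sum_congr rfl fun x _ => ?_
  rw [star_mul']
  ring

/-- The expression is the Gaussian integral of |A - B|², with A and B as set in the proof. The
factor ‖z‖^k in A turns the direction into z itself in the cross term, which makes all three terms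
computable. -/
lemma quadratic_form_nonneg {d k m : ℕ} (e : PureState d) (w : (Fin k → Fin d) → ℂ)
    (Ψ : (Fin (k + m) → Fin d) → ℂ)
    (hΨ : ∀ (π : Equiv.Perm (Fin (k + m))) (x : Fin (k + m) → Fin d), Ψ (x ∘ π) = Ψ x) :
    0 ≤ (((d + m).ascFactorial k : ℕ) * m ! * (∑ y, star (contract w Ψ y) * contract w Ψ y)
      - 2 * ((k + m)! * ∑ y, star (contract w Ψ y) * contract w Ψ y)
      + (k + m)! * ∫ u : PureState d, star (powerPairing (fun j => u.1 j) w) *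
          powerPairing (fun j => u.1 j) w ∂deFinettiMeasure e Ψ).re := by
  have hc : Continuous fun u : PureState d => star (powerPairing (fun j => u.1 j) w) *
          powerPairing (fun j => u.1 j) w := by
    have : Continuous fun u : PureState d => powerPairing (fun j => u.1 j) w :=
      (continuous_powerPairing w).comp (by fun_prop)
    fun_prop
  have i1 := integrable_powerPairing k (contract w Ψ) (contract w Ψ)
  obtain ⟨i2, e2⟩ := integral_cross_term w Ψ hΨ
  have i3 := integrable_mul_direction e Ψ hc
  have i12 := i1.sub (i2.const_mul 2)
  simp only [Pi.sub_def] at i12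
  rw [← integral_deFinettiMeasure e Ψ hc, ← e2,
    ← integral_powerPairing k _ _ (contract_comp_perm w Ψ hΨ), ← integral_const_mul,
    ← integral_sub i1 (i2.const_mul 2), ← integral_add i12 i3]
  have hre := integral_re (𝕜 := ℂ) (i12.add i3)
  simp only [Pi.add_apply] at hre
  refine le_of_le_of_eq ?_ hre
  refine integral_nonneg fun z => ?_
  simp only [Pi.zero_apply]
  set A : ℂ := (‖WithLp.toLp 2 z‖ : ℂ) ^ k * powerPairing z (contract w Ψ) with hA
  set B : ℂ := star (powerPairing (fun j => (direction e z).1 j) w) * powerPairing z Ψ with hB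
  have hr : star (‖WithLp.toLp 2 z‖ : ℂ) = (‖WithLp.toLp 2 z‖ : ℂ) := Complex.conj_ofReal _
  have t1 : sqNorm z ^ k * (star (powerPairing z (contract w Ψ)) * powerPairing z (contract w Ψ)) =
      star A * A := by
    rw [sqNorm_eq, hA, star_mul', star_pow, hr]
    ring
  have t2 : star (powerPairing z (contract w Ψ)) * (star (powerPairing z w) * powerPairing z Ψ) =
      star A * B := by
    rw [powerPairing_direction e z w, hA, hB, star_mul', star_mul', star_pow, hr]
    ring
  have t3 : star (powerPairing z Ψ) * powerPairing z Ψ *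
      (star (powerPairing (fun j => (direction e z).1 j) w) *
        powerPairing (fun j => (direction e z).1 j) w) = star B * B := by
    rw [hB, star_mul', star_star]
    ring
  rw [t1, t2, t3]
  -- The cross term need not be real, but its real part is what |A - B|² contains.
  have : RCLike.re (star A * A - 2 * (star A * B) + star B * B) = Complex.normSq (A - B) := by
    simp [Complex.normSq_apply]
    ring
  rw [this]
  exact Complex.normSq_nonneg _

/-! ### Trace norm of a difference of positive operators -/

section TraceNorm

open scoped MatrixOrder Matrix.Norms.L2Operator

lemma traceNorm_eq_sum_abs_eigenvalues {ι : Type*} [Fintype ι] [DecidableEq ι]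
    {A : Matrix ι ι ℂ} (hA : A.IsHermitian) :
    traceNorm A = (1 / 2) * ∑ i, |hA.eigenvalues i| := by
  unfold traceNorm
  have h : CFC.abs A = hA.cfc (fun x => ‖x‖) := by
    rw [CFC.abs_eq_cfc_norm A hA.isSelfAdjoint, hA.cfc_eq]
  rw [h, Matrix.IsHermitian.cfc, Unitary.conjStarAlgAut_apply, Matrix.trace_mul_cycle,
    Unitary.coe_star_mul_self, one_mul, Matrix.trace_diagonal]
  simp

lemma traceNorm_sub_le {ι : Type*} [Fintype ι] [DecidableEq ι] {X Y : Matrix ι ι ℂ}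
    (hX : X.PosSemidef) (hY : Y.PosSemidef) :
    traceNorm (X - Y) ≤ (1 / 2) * (X.trace + Y.trace).re := by
  have hA : (X - Y).IsHermitian := hX.isHermitian.sub hY.isHermitian
  rw [traceNorm_eq_sum_abs_eigenvalues hA]
  set U : Matrix ι ι ℂ := (hA.eigenvectorUnitary : Matrix ι ι ℂ) with hU
  have hUU : U * Uᴴ = 1 := Unitary.coe_mul_star_self hA.eigenvectorUnitary
  have hUU' : Uᴴ * U = 1 := Unitary.coe_star_mul_self hA.eigenvectorUnitary
  -- In an eigenbasis of X - Y each eigenvalue is X_ii - Y_ii with both entries nonnegative, so its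
  -- modulus is at most X_ii + Y_ii.
  have hd : Uᴴ * (X - Y) * U = Matrix.diagonal (fun i => (hA.eigenvalues i : ℂ)) := by
    have hs := hA.spectral_theorem
    rw [Unitary.conjStarAlgAut_apply] at hs
    have hs' : X - Y = U * Matrix.diagonal (fun i => (hA.eigenvalues i : ℂ)) * Uᴴ := hs
    conv_lhs => rw [hs']
    rw [← mul_assoc, ← mul_assoc, hUU', one_mul, mul_assoc, hUU', mul_one]
  have htr : ∀ Z : Matrix ι ι ℂ, Z.trace = ∑ i, (Uᴴ * Z * U) i i := by
    intro Z
    change _ = (Uᴴ * Z * U).trace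
    rw [Matrix.trace_mul_cycle, hUU, one_mul]
  rw [htr X, htr Y, ← Finset.sum_add_distrib, Complex.re_sum]
  refine mul_le_mul_of_nonneg_left (Finset.sum_le_sum fun i _ => ?_) (by norm_num)
  have hx := (Complex.le_def.1 (Matrix.PosSemidef.diag_nonneg
    (hX.conjTranspose_mul_mul_same U) (i := i))).1
  have hy := (Complex.le_def.1 (Matrix.PosSemidef.diag_nonneg
    (hY.conjTranspose_mul_mul_same U) (i := i))).1
  have hi := congrArg Complex.re (congrFun (congrFun hd i) i)
  rw [mul_sub, sub_mul, Matrix.diagonal_apply_eq, Matrix.sub_apply, Complex.sub_re,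
    Complex.ofReal_re] at hi
  rw [← hi, Complex.add_re, abs_le]
  simp only [Complex.zero_re] at hx hy
  constructor <;> linarith

end TraceNorm

/-! ### Ratio of the dimensions of symmetric subspaces -/

/-- Bernoulli's inequality in disguise: raising e by one changes the rising factorial by a factor
whose inverse (m+1+e)/(m+1+e+k) is at least m/(m+k) = 1 - c, and (1 - ec)(1 - c) ≥ 1 - (e+1)c. -/
lemma ascFactorial_lower_bound (m k e : ℕ) (h : 0 < k + m) :
    (1 - e * (k / (k + m) : ℝ)) * ((m + 1 + e).ascFactorial k : ℝ) ≤
      ((m + 1).ascFactorial k : ℝ) := by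
  have hkm : (0 : ℝ) < k + m := by exact_mod_cast h
  set c : ℝ := k / (k + m) with hc
  have hc0 : 0 ≤ c := by positivity
  induction e with
  | zero => simp
  | succ e ih =>
    -- The induction hypothesis is useful only while 1 - ec ≥ 0; beyond that the left side is
    -- nonpositive.
    rcases le_total ((e : ℝ) * c) 1 with h1 | h1
    · refine le_trans ?_ ih
      have hrec : ((m + 1 + e : ℕ) : ℝ) * ((m + 1 + (e + 1)).ascFactorial k : ℝ) =
          ((m + 1 + e + k : ℕ) : ℝ) * ((m + 1 + e).ascFactorial k : ℝ) := by
        exact_mod_cast Nat.succ_ascFactorial (m + 1 + e) k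
      set a : ℝ := ((m + 1 + e).ascFactorial k : ℝ)
      set b : ℝ := ((m + 1 + (e + 1)).ascFactorial k : ℝ)
      have hb : 0 ≤ b := Nat.cast_nonneg _
      have hab : (1 - c) * b ≤ a := by
        have hN : (0 : ℝ) < m + 1 + e + k := by positivity
        have h2 : a = (m + 1 + e) / (m + 1 + e + k) * b := by
          push_cast at hrec
          field_simp
          linarith
        rw [h2]
        refine mul_le_mul_of_nonneg_right ?_ hb
        have h3 : 1 - c = m / (k + m) := by
          rw [hc]
          field_simp
          ring
        rw [h3, div_le_div_iff₀ hkm hN]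
        have : (0 : ℝ) ≤ k * (1 + e) := by positivity
        nlinarith
      calc (1 - ((e + 1 : ℕ) : ℝ) * c) * b ≤ (1 - e * c) * ((1 - c) * b) := by
            rw [← mul_assoc]
            refine mul_le_mul_of_nonneg_right ?_ hb
            push_cast
            nlinarith [mul_nonneg (mul_nonneg (Nat.cast_nonneg (α := ℝ) e) hc0) hc0]
        _ ≤ (1 - e * c) * a := mul_le_mul_of_nonneg_left hab (by linarith)
    · have : (1 - ((e + 1 : ℕ) : ℝ) * c) ≤ 0 := by
        push_cast
        nlinarith
      exact (mul_nonpos_of_nonpos_of_nonneg this (Nat.cast_nonneg _)).trans (Nat.cast_nonneg _)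

lemma dimension_ratio_bounds {d k m : ℕ} (hd : 0 < d) (h : 0 < k + m) :
    ((k + m)! : ℝ) / ((d + m).ascFactorial k * m !) ≤ 1 ∧
    1 - (d : ℝ) * k / (k + m : ℕ) ≤ ((k + m)! : ℝ) / ((d + m).ascFactorial k * m !) := by
  obtain ⟨e, rfl⟩ := Nat.exists_eq_add_of_le' hd
  have hm : (0 : ℝ) < m ! := by exact_mod_cast m.factorial_pos
  have hidx : e + 1 + m = m + 1 + e := by ring
  have hD : (0 : ℝ) < ((m + 1 + e).ascFactorial k : ℝ) := by
    have := Nat.ascFactorial_pos (m + e) k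
    have h2 : m + 1 + e = m + e + 1 := by ring
    rw [h2]
    exact_mod_cast this
  have hf : ((k + m)! : ℝ) = m ! * ((m + 1).ascFactorial k : ℝ) := by
    rw [add_comm, ← Nat.factorial_mul_ascFactorial]
    push_cast
    rfl
  have hr : ((k + m)! : ℝ) / ((e + 1 + m).ascFactorial k * m !) =
      ((m + 1).ascFactorial k : ℝ) / (m + 1 + e).ascFactorial k := by
    rw [hf, hidx]
    field_simp
  rw [hr]
  constructor
  · rw [div_le_one hD]
    exact_mod_cast Nat.ascFactorial_le k (by omega)
  · rw [le_div_iff₀ hD]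
    -- With e = d - 1 the previous lemma gives the stronger constant (d - 1)k/n, which is relaxed to
    -- dk/n.
    refine le_trans (mul_le_mul_of_nonneg_right ?_ hD.le) (ascFactorial_lower_bound m k e h)
    have : (0 : ℝ) ≤ k / (k + m) := by positivity
    push_cast
    rw [mul_div_assoc]
    nlinarith

/-! ### Quadratic forms, traces and positivity of the two states -/

lemma partialTrace_ketBra_apply {d k m : ℕ} (Ψ : TensorSpace d (k + m)) (x y : Fin k → Fin d) :
    partialTrace rfl (ketBra Ψ) x y =
      ∑ z : Fin m → Fin d, Ψ (Fin.append x z) * star (Ψ (Fin.append y z)) := by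
  simp [partialTrace, ketBra, Matrix.vecMulVec_apply]

lemma isHermitian_partialTrace_ketBra {d k m : ℕ} (Ψ : TensorSpace d (k + m)) :
    (partialTrace (k := k) rfl (ketBra Ψ)).IsHermitian := by
  ext x y
  rw [Matrix.conjTranspose_apply, partialTrace_ketBra_apply, partialTrace_ketBra_apply, star_sum]
  refine Finset.sum_congr rfl fun z _ => ?_
  rw [star_mul', star_star, mul_comm]

lemma quadraticForm_partialTrace {d k m : ℕ} (Ψ : TensorSpace d (k + m))
    (w : (Fin k → Fin d) → ℂ) :
    star w ⬝ᵥ (partialTrace rfl (ketBra Ψ) *ᵥ w) =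
      ∑ y, star (contract w Ψ y) * contract w Ψ y := by
  have h : ∀ y, star (contract w Ψ y) * contract w Ψ y = ∑ x, ∑ x', star (w x) *
      (Ψ (Fin.append x y) * star (Ψ (Fin.append x' y)) * w x') := by
    intro y
    rw [mul_comm, contract, star_sum, Finset.sum_mul_sum]
    refine Finset.sum_congr rfl fun x _ => Finset.sum_congr rfl fun x' _ => ?_
    rw [star_mul', star_star]
    ring
  simp only [h]
  rw [Finset.sum_comm]
  simp only [dotProduct, Matrix.mulVec, partialTrace_ketBra_apply, Pi.star_apply, Finset.mul_sum,
    Finset.sum_mul]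
  exact Finset.sum_congr rfl fun x _ => Finset.sum_comm

lemma sum_star_mul_self {ι : Type*} [Fintype ι] {v : EuclideanSpace ℂ ι} (hv : ‖v‖ = 1) :
    ∑ x, star (v x) * v x = 1 := by
  have : ((‖v‖ ^ 2 : ℝ) : ℂ) = 1 := by simp [hv]
  rw [← this, EuclideanSpace.norm_sq_eq, Complex.ofReal_sum]
  refine Finset.sum_congr rfl fun x _ => ?_
  simp [Complex.conj_mul']

lemma trace_partialTrace_ketBra {d k m : ℕ} (Ψ : TensorSpace d (k + m)) :
    (partialTrace (k := k) rfl (ketBra Ψ)).trace = ∑ x, star (Ψ x) * Ψ x := by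
  rw [sum_append]
  simp only [Matrix.trace, Matrix.diag_apply, partialTrace_ketBra_apply, mul_comm]

lemma tensorPower_ketBra_apply {d k : ℕ} (u : EuclideanSpace ℂ (Fin d)) (x y : Fin k → Fin d) :
    tensorPower k (ketBra u) x y =
      tensorCoeff (fun j => u j) x * star (tensorCoeff (fun j => u j) y) := by
  simp [tensorPower, ketBra, tensorCoeff, Matrix.vecMulVec_apply, Finset.prod_mul_distrib]

lemma continuous_tensorPower_ketBra {d k : ℕ} (x y : Fin k → Fin d) :
    Continuous fun u : PureState d =>
      tensorPower k (ketBra (u : EuclideanSpace ℂ (Fin d))) x y := by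
  simp only [tensorPower_ketBra_apply]
  have h : ∀ x : Fin k → Fin d, Continuous fun u : PureState d => tensorCoeff (fun j => u.1 j) x :=
    fun x => (continuous_tensorCoeff x).comp (by fun_prop)
  exact (h x).mul (h y).star

lemma integrable_tensorPower_ketBra {d k : ℕ} (μ : Measure (PureState d)) [IsFiniteMeasure μ]
    (x y : Fin k → Fin d) :
    Integrable (fun u : PureState d =>
      tensorPower k (ketBra (u : EuclideanSpace ℂ (Fin d))) x y) μ :=
  (continuous_tensorPower_ketBra x y).integrable_of_hasCompactSupport
    (HasCompactSupport.of_compactSpace _)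

lemma isHermitian_productMixture {d : ℕ} (k : ℕ) (μ : Measure (PureState d)) :
    (productMixture k μ).IsHermitian := by
  ext x y
  simp only [Matrix.conjTranspose_apply, productMixture, Matrix.of_apply,
    tensorPower_ketBra_apply]
  rw [Complex.star_def, ← integral_conj]
  refine integral_congr_ae (Filter.Eventually.of_forall fun u => ?_)
  simp [mul_comm]

lemma quadraticForm_productMixture {d k : ℕ} (μ : Measure (PureState d)) [IsFiniteMeasure μ]
    (w : (Fin k → Fin d) → ℂ) :
    star w ⬝ᵥ (productMixture k μ *ᵥ w) =
      ∫ u : PureState d, star (powerPairing (fun j => u.1 j) w) *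
        powerPairing (fun j => u.1 j) w ∂μ := by
  have h : ∀ u : PureState d, star (powerPairing (fun j => u.1 j) w) *
        powerPairing (fun j => u.1 j) w =
      ∑ x, ∑ y, star (w x) * (tensorPower k (ketBra u.1) x y * w y) := by
    intro u
    unfold powerPairing
    rw [star_sum, Finset.sum_mul_sum]
    refine Finset.sum_congr rfl fun x _ => Finset.sum_congr rfl fun y _ => ?_
    rw [tensorPower_ketBra_apply, star_mul', star_star]
    ring
  have hi : ∀ x y, Integrable (fun u : PureState d =>
      star (w x) * (tensorPower k (ketBra u.1) x y * w y)) μ := fun x y =>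
    ((integrable_tensorPower_ketBra μ x y).mul_const _).const_mul _
  simp only [h]
  rw [integral_finsetSum _ fun x _ => integrable_finsetSum _ fun y _ => hi x y]
  simp only [dotProduct, Matrix.mulVec, Pi.star_apply, Finset.mul_sum]
  refine Finset.sum_congr rfl fun x _ => ?_
  rw [integral_finsetSum _ fun y _ => hi x y]
  refine Finset.sum_congr rfl fun y _ => ?_
  rw [integral_const_mul, integral_mul_const]
  rfl

lemma trace_productMixture {d : ℕ} (k : ℕ) (μ : Measure (PureState d)) [IsProbabilityMeasure μ] :
    (productMixture k μ).trace = 1 := by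
  have h : ∀ u : PureState d, ∑ x, tensorPower k (ketBra u.1) x x = 1 := by
    intro u
    simp only [tensorPower, Matrix.of_apply]
    rw [← Fintype.sum_pow (fun j => ketBra u.1 j j)]
    simp only [ketBra, Matrix.vecMulVec_apply, mul_comm (u.1 _)]
    rw [sum_star_mul_self (mem_sphere_zero_iff_norm.1 u.2), one_pow]
  simp only [Matrix.trace, Matrix.diag_apply, productMixture, Matrix.of_apply]
  rw [← integral_finsetSum _ fun x _ => integrable_tensorPower_ketBra μ x x]
  simp [h]

lemma posSemidef_of_re_nonneg {ι : Type*} [Fintype ι] {A : Matrix ι ι ℂ} (hA : A.IsHermitian)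
    (h : ∀ w : ι → ℂ, 0 ≤ (star w ⬝ᵥ (A *ᵥ w)).re) : A.PosSemidef := by
  refine Matrix.PosSemidef.of_dotProduct_mulVec_nonneg hA fun w => ?_
  rw [Complex.nonneg_iff]
  exact ⟨h w, (hA.im_star_dotProduct_mulVec_self w).symm⟩

lemma posSemidef_partialTrace_ketBra {d k m : ℕ} (Ψ : TensorSpace d (k + m)) :
    (partialTrace (k := k) rfl (ketBra Ψ)).PosSemidef := by
  refine Matrix.PosSemidef.of_dotProduct_mulVec_nonneg (isHermitian_partialTrace_ketBra Ψ)
    fun w => ?_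
  rw [quadraticForm_partialTrace]
  exact Finset.sum_nonneg fun y _ => star_mul_self_nonneg _

lemma posSemidef_productMixture {d k : ℕ} (μ : Measure (PureState d)) [IsFiniteMeasure μ] :
    (productMixture k μ).PosSemidef := by
  refine posSemidef_of_re_nonneg (isHermitian_productMixture k μ) fun w => ?_
  rw [quadraticForm_productMixture]
  refine (integral_nonneg fun u => ?_ : 0 ≤ ∫ u : PureState d,
    Complex.normSq (powerPairing (fun j => u.1 j) w) ∂μ).trans_eq ?_
  · exact Complex.normSq_nonneg _
  · rw [← Complex.ofReal_re (∫ u : PureState d, _ ∂μ), ← integral_complex_ofReal]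
    congr 2
    funext u
    rw [Complex.normSq_eq_conj_mul_self]
    rfl

/-! ### The trace distance bound for the de Finetti mixture -/

/-- The trace distance between the reduced state of a symmetric pure state and the mixture of
product states given by its de Finetti measure. -/
theorem traceNorm_partialTrace_sub_productMixture_le {d k m : ℕ} (h : 0 < k + m) (e : PureState d)
    (hd : 0 < d) (Ψ : TensorSpace d (k + m)) (hΨ : Ψ ∈ symSubspace d (k + m)) (hnorm : ‖Ψ‖ = 1)
    [IsProbabilityMeasure (deFinettiMeasure e fun x => Ψ x)] :
    traceNorm (partialTrace rfl (ketBra Ψ) - productMixture k (deFinettiMeasure e fun x => Ψ x)) ≤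
      2 * ((d : ℝ) * k / (k + m : ℕ)) := by
  obtain ⟨hr1, hr⟩ := dimension_ratio_bounds (d := d) (k := k) (m := m) hd h
  set D : ℝ := (d + m).ascFactorial k * m ! with hD
  set r : ℝ := ((k + m)! : ℝ) / D with hrdef
  set ξ := partialTrace (k := k) rfl (ketBra Ψ) with hξ
  set σ := productMixture k (deFinettiMeasure e fun x => Ψ x) with hσ
  have hDpos : 0 < D := by
    have := Nat.ascFactorial_pos (d + m - 1) k
    rw [Nat.sub_add_cancel (by omega)] at this
    have := m.factorial_pos
    rw [hD]
    positivity
  have hn : ((k + m)! : ℝ) = r * D := by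
    rw [hrdef]
    field_simp
  -- This is the key positivity divided by D, since n! = rD.
  have hR : (((1 - 2 * r : ℝ) : ℂ) • ξ + (r : ℂ) • σ).PosSemidef := by
    have hsm : ∀ (c : ℝ) {A : TensorOp d k}, A.IsHermitian → ((c : ℂ) • A).IsHermitian := by
      intro c A hA
      ext x y
      have := congrFun (congrFun hA x) y
      simp only [Matrix.conjTranspose_apply, Matrix.smul_apply, smul_eq_mul, star_mul'] at this ⊢
      rw [this, Complex.star_def, Complex.conj_ofReal]
    refine posSemidef_of_re_nonneg ((hsm _ (isHermitian_partialTrace_ketBra Ψ)).add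
      (hsm _ (isHermitian_productMixture k _))) fun w => ?_
    have hq := quadratic_form_nonneg e w (fun x => Ψ x) hΨ
    rw [← quadraticForm_partialTrace, ← quadraticForm_productMixture, ← hξ, ← hσ] at hq
    rw [Matrix.add_mulVec, dotProduct_add, Matrix.smul_mulVec, Matrix.smul_mulVec,
      dotProduct_smul, dotProduct_smul]
    set q := star w ⬝ᵥ (ξ *ᵥ w)
    set s := star w ⬝ᵥ (σ *ᵥ w)
    have hq' : 0 ≤ D * q.re - 2 * ((k + m)! * q.re) + (k + m)! * s.re := by
      have e1 : (((d + m).ascFactorial k : ℕ) * m ! * q - 2 * ((k + m)! * q) + (k + m)! * s : ℂ) =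
          (D : ℂ) * q - (2 * (k + m)! : ℝ) * q + ((k + m)! : ℝ) * s := by
        rw [hD]
        push_cast
        ring
      rw [e1, Complex.add_re, Complex.sub_re, Complex.re_ofReal_mul, Complex.re_ofReal_mul,
        Complex.re_ofReal_mul] at hq
      linarith
    rw [hn] at hq'
    have : 0 ≤ D * ((1 - 2 * r) * q.re + r * s.re) := by linarith
    have := nonneg_of_mul_nonneg_right this hDpos
    simpa using this
  have hcast : ∀ {c : ℝ}, 0 ≤ c → (0 : ℂ) ≤ (c : ℂ) := fun hc => Complex.zero_le_real.2 hc
  have hX : (((2 * (1 - r) : ℝ) : ℂ) • ξ).PosSemidef :=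
    (posSemidef_partialTrace_ketBra Ψ).smul (hcast (by linarith))
  have hY := hR.add ((posSemidef_productMixture (k := k)
    (deFinettiMeasure e fun x => Ψ x)).smul (hcast (sub_nonneg.2 hr1)))
  -- The coefficients make both terms positive: 1 - r ≥ 0, and the bracket is the positive operator
  -- `hR` plus a nonnegative multiple of σ. Each has trace 2(1 - r).
  have hdecomp : ξ - σ = ((2 * (1 - r) : ℝ) : ℂ) • ξ -
      ((((1 - 2 * r : ℝ) : ℂ) • ξ + (r : ℂ) • σ) + ((1 - r : ℝ) : ℂ) • σ) := by
    push_cast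
    module
  have hξtr : ξ.trace = 1 := by
    rw [hξ, trace_partialTrace_ketBra, sum_star_mul_self hnorm]
  rw [hdecomp]
  refine (traceNorm_sub_le hX hY).trans ?_
  simp only [Matrix.trace_add, Matrix.trace_smul, hξtr, hσ, trace_productMixture, smul_eq_mul,
    mul_one, Complex.add_re, Complex.ofReal_re]
  linarith

/-! ### A measurable section from pure states to unitaries -/

section UnitarySection

variable {d : ℕ} (i₀ : Fin d)

/-- The multiple of the unit vector `u` by a phase whose `i₀`-th coordinate is real and
nonnegative. -/
def phaseAligned (u : PureState d) (i : Fin d) : ℂ :=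
  (if u.1 i₀ = 0 then 1 else star (u.1 i₀) / ‖u.1 i₀‖) * u.1 i

lemma phaseAligned_self (u : PureState d) : phaseAligned i₀ u i₀ = ‖u.1 i₀‖ := by
  unfold phaseAligned
  split_ifs with h
  · simp [h]
  · have : (‖u.1 i₀‖ : ℂ) ≠ 0 := by simpa using h
    have h2 : star (u.1 i₀) * u.1 i₀ = (‖u.1 i₀‖ : ℂ) ^ 2 := by
      simpa using Complex.conj_mul' (u.1 i₀)
    rw [div_mul_eq_mul_div, h2]
    field_simp

/-- A global phase cancels in the ket-bra, so aligning it does not alter the pure state. -/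
lemma phaseAligned_mul_star (u : PureState d) (i j : Fin d) :
    phaseAligned i₀ u i * star (phaseAligned i₀ u j) = u.1 i * star (u.1 j) := by
  unfold phaseAligned
  split_ifs with h
  · simp
  · have : (‖u.1 i₀‖ : ℂ) ≠ 0 := by simpa using h
    have h2 : star (u.1 i₀) * u.1 i₀ = (‖u.1 i₀‖ : ℂ) ^ 2 := by
      simpa using Complex.conj_mul' (u.1 i₀)
    have h3 : star (‖u.1 i₀‖ : ℂ) = (‖u.1 i₀‖ : ℂ) := Complex.conj_ofReal _
    rw [star_mul', star_div₀, star_star, h3]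
    calc _ = (star (u.1 i₀) * u.1 i₀) / (‖u.1 i₀‖ : ℂ) ^ 2 * (u.1 i * star (u.1 j)) := by
          field_simp
      _ = _ := by
          rw [h2]
          field_simp

/-- The normal vector of the reflection that exchanges the basis vector `i₀` and
`phaseAligned i₀ u`. -/
def reflectionNormal (u : PureState d) (i : Fin d) : ℂ :=
  (if i = i₀ then 1 else 0) - phaseAligned i₀ u i

/-- Alignment makes the overlap with the basis vector real, so a Householder reflection can exchange
the two unit vectors. This squared norm is its denominator. -/
lemma star_reflectionNormal_dotProduct (u : PureState d) :
    star (reflectionNormal i₀ u) ⬝ᵥ reflectionNormal i₀ u = 2 - 2 * (‖u.1 i₀‖ : ℂ) := by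
  have h : ∀ i, star (reflectionNormal i₀ u) i * reflectionNormal i₀ u i =
      (if i = i₀ then 1 - phaseAligned i₀ u i - star (phaseAligned i₀ u i) else 0) +
        star (u.1 i) * u.1 i := by
    intro i
    rw [mul_comm (star (u.1 i)), ← phaseAligned_mul_star i₀ u i i]
    simp only [Pi.star_apply, reflectionNormal, star_sub]
    split_ifs
    · simp
      ring
    · simp
      ring
  simp only [dotProduct, h]
  rw [Finset.sum_add_distrib, sum_star_mul_self (mem_sphere_zero_iff_norm.1 u.2), Finset.sum_ite_eq']
  simp [phaseAligned_self]
  ring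

/-- A unitary reflection that maps the basis vector `i₀` to `phaseAligned i₀ u`. -/
def reflectionMatrix (u : PureState d) : Matrix (Fin d) (Fin d) ℂ :=
  1 - (2 / (2 - 2 * (‖u.1 i₀‖ : ℂ))) •
    Matrix.vecMulVec (reflectionNormal i₀ u) (star (reflectionNormal i₀ u))

lemma reflectionMatrix_mem (u : PureState d) :
    reflectionMatrix i₀ u ∈ Matrix.unitaryGroup (Fin d) ℂ := by
  have hstar : star (reflectionMatrix i₀ u) = reflectionMatrix i₀ u := by
    unfold reflectionMatrix
    rw [Matrix.star_eq_conjTranspose, Matrix.conjTranspose_sub, Matrix.conjTranspose_smul,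
      Matrix.conjTranspose_vecMulVec, star_star, Matrix.conjTranspose_one]
    simp
  rw [Matrix.mem_unitaryGroup_iff, hstar]
  unfold reflectionMatrix
  set w := reflectionNormal i₀ u
  set s : ℂ := 2 - 2 * (‖u.1 i₀‖ : ℂ) with hs
  have hW : Matrix.vecMulVec w (star w) * Matrix.vecMulVec w (star w) =
      s • Matrix.vecMulVec w (star w) := by
    rw [Matrix.vecMulVec_mul_vecMulVec, star_reflectionNormal_dotProduct, Matrix.vecMulVec_smul]
  rw [sub_mul, mul_sub, mul_sub, one_mul, one_mul, mul_one, Matrix.smul_mul, Matrix.mul_smul, hW,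
    smul_smul, smul_smul]
  -- If s = 0, the aligned vector is the basis vector itself; division by zero gives 0 and the
  -- reflection degenerates to the identity.
  have hcoef : 2 / s * (2 / s) * s = 2 / s + 2 / s := by
    by_cases h0 : s = 0
    · simp [h0]
    · field_simp
      norm_num
  rw [hcoef]
  module

lemma reflectionMatrix_apply (u : PureState d) (i : Fin d) :
    reflectionMatrix i₀ u i i₀ = phaseAligned i₀ u i := by
  have h1 : star (reflectionNormal i₀ u i₀) = 1 - (‖u.1 i₀‖ : ℂ) := by
    simp [reflectionNormal, phaseAligned_self]
  have h2 : (2 / (2 - 2 * (‖u.1 i₀‖ : ℂ))) *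
      (reflectionNormal i₀ u i * (1 - (‖u.1 i₀‖ : ℂ))) = reflectionNormal i₀ u i := by
    by_cases h0 : (1 - (‖u.1 i₀‖ : ℂ)) = 0
    · have hw : star (reflectionNormal i₀ u) ⬝ᵥ reflectionNormal i₀ u = 0 := by
        rw [star_reflectionNormal_dotProduct]
        linear_combination 2 * h0
      have hz : reflectionNormal i₀ u = 0 := by
        rwa [dotProduct_star_self_eq_zero] at hw
      rw [hz]
      simp
    · have : 2 - 2 * (‖u.1 i₀‖ : ℂ) = 2 * (1 - (‖u.1 i₀‖ : ℂ)) := by ring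
      rw [this]
      field_simp
  simp only [reflectionMatrix, Matrix.sub_apply, Matrix.smul_apply, Matrix.vecMulVec_apply,
    Pi.star_apply, smul_eq_mul, h1, h2]
  simp [reflectionNormal, Matrix.one_apply]

/-- A measurable choice of a unitary that maps the basis vector `i₀` to a multiple of `u`. -/
def unitarySection (u : PureState d) : Matrix.unitaryGroup (Fin d) ℂ :=
  ⟨reflectionMatrix i₀ u, reflectionMatrix_mem i₀ u⟩

/-- The topology of the unitary group is induced by the matrix entries, so every open set is the
preimage of an open set of the finite product. -/
lemma measurable_unitary_of_entries {α : Type*} [MeasurableSpace α]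
    {f : α → Matrix.unitaryGroup (Fin d) ℂ}
    (hf : ∀ i j, Measurable fun a => (f a : Matrix (Fin d) (Fin d) ℂ) i j) : Measurable f := by
  have hF : Measurable fun a => (fun i j => (f a : Matrix (Fin d) (Fin d) ℂ) i j) :=
    measurable_pi_iff.2 fun i => measurable_pi_iff.2 fun j => hf i j
  refine measurable_of_isOpen fun s hs => ?_
  obtain ⟨t, ht, rfl⟩ := isOpen_induced_iff.1 hs
  exact hF (IsOpen.measurableSet (α := Fin d → Fin d → ℂ) ht)

lemma measurable_unitarySection : Measurable (unitarySection i₀) := by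
  have hco : ∀ i, Measurable fun u : PureState d => u.1 i := fun i => by fun_prop
  have hph : ∀ i, Measurable fun u : PureState d => phaseAligned i₀ u i := by
    intro i
    unfold phaseAligned
    refine Measurable.mul (Measurable.ite (hco i₀ (measurableSet_singleton 0))
      measurable_const ?_) (hco i)
    exact (continuous_star.measurable.comp (hco i₀)).div (by fun_prop)
  have hn : ∀ i, Measurable fun u : PureState d => reflectionNormal i₀ u i := fun i =>
    measurable_const.sub (hph i)
  refine measurable_unitary_of_entries fun i j => ?_
  simp only [unitarySection, reflectionMatrix, Matrix.sub_apply, Matrix.smul_apply,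
    Matrix.vecMulVec_apply, Pi.star_apply, smul_eq_mul]
  exact measurable_const.sub (Measurable.mul (by fun_prop) ((hn i).mul (continuous_star.measurable.comp (hn j))))

/-- The `k`-fold tensor power of the basis vector `i₀`. -/
def basisPower (k : ℕ) : TensorSpace d k := EuclideanSpace.single (fun _ => i₀) 1

lemma symRep_basisPower {k : ℕ} (g : Matrix.unitaryGroup (Fin d) ℂ) (x : Fin k → Fin d) :
    symRep k g (basisPower i₀ k) x = ∏ i, (g : Matrix (Fin d) (Fin d) ℂ) (x i) i₀ := by
  simp [symRep, basisPower, Matrix.mulVec, dotProduct, tensorPower]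

lemma isHighestWeightVector_basisPower (k : ℕ) (h0 : (i₀ : ℕ) = 0) :
    IsHighestWeightVector (basisPower i₀ k) := by
  refine ⟨fun π x => ?_, by simp [basisPower], ?_, fun h t ht => ?_⟩
  · have : (x ∘ π = fun _ => i₀) ↔ x = fun _ => i₀ := by
      constructor
      · intro hx
        funext i
        simpa using congrFun hx (π.symm i)
      · rintro rfl
        rfl
    simp [basisPower, this]
  · simp [basisPower]
  · ext x
    have hw : ∏ i, t i ^ rowWeight d k i = t i₀ ^ k := by
      rw [Finset.prod_eq_single i₀]
      · simp [rowWeight, h0]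
      · intro i _ hi
        have : (i : ℕ) ≠ 0 := fun h' => hi (Fin.ext (h'.trans h0.symm))
        simp [rowWeight, this]
      · simp
    rw [symRep_basisPower, ht, hw]
    by_cases hx : x = fun _ => i₀
    · simp [hx, basisPower]
    · obtain ⟨i, hi⟩ : ∃ i, x i ≠ i₀ := by
        by_contra! hc
        exact hx (funext hc)
      rw [Finset.prod_eq_zero (Finset.mem_univ i) (Matrix.diagonal_apply_ne t hi)]
      simp [basisPower, hx]

lemma ketBra_symRep_unitarySection {k : ℕ} (u : PureState d) :
    ketBra (symRep k (unitarySection i₀ u) (basisPower i₀ k)) =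
      tensorPower k (ketBra (u : EuclideanSpace ℂ (Fin d))) := by
  ext x y
  simp only [ketBra, tensorPower, Matrix.vecMulVec_apply, symRep_basisPower, Matrix.of_apply,
    star_prod]
  rw [← Finset.prod_mul_distrib]
  refine Finset.prod_congr rfl fun i _ => ?_
  change reflectionMatrix i₀ u _ _ * star (reflectionMatrix i₀ u _ _) = _
  rw [reflectionMatrix_apply, reflectionMatrix_apply, phaseAligned_mul_star]

lemma coherentMixture_map_unitarySection (k : ℕ) (μ : Measure (PureState d)) :
    coherentMixture (basisPower i₀ k) (μ.map (unitarySection i₀)) = productMixture k μ := by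
  ext x y
  simp only [coherentMixture, productMixture, Matrix.of_apply]
  rw [integral_map (measurable_unitarySection i₀).aemeasurable]
  · simp only [ketBra_symRep_unitarySection]
  · refine Measurable.aestronglyMeasurable (Continuous.measurable ?_)
    simp only [ketBra, Matrix.vecMulVec_apply, symRep_basisPower]
    have h : ∀ i, Continuous fun g : Matrix.unitaryGroup (Fin d) ℂ =>
        (g : Matrix (Fin d) (Fin d) ℂ) i i₀ := fun i =>
      continuous_subtype_val.matrix_elem i i₀
    exact (continuous_finsetProd _ fun i _ => h _).mul
      (continuous_finsetProd _ fun i _ => h _).star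

lemma productMixture_mem_coherentStates (k : ℕ) (h0 : (i₀ : ℕ) = 0) (μ : Measure (PureState d))
    [IsProbabilityMeasure μ] : productMixture k μ ∈ coherentStates d k :=
  ⟨basisPower i₀ k, isHighestWeightVector_basisPower i₀ k h0, μ.map (unitarySection i₀),
    Measure.isProbabilityMeasure_map (measurable_unitarySection i₀).aemeasurable,
    (coherentMixture_map_unitarySection i₀ k μ).symm⟩

end UnitarySection

/-! ### Assembly of the two forms -/

/-- The two forms of the de Finetti bound, with `n = k + m`. -/
theorem exists_deFinetti_approximation {d n k m : ℕ} (hkm : k + m = n) (hn : 0 < n)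
    (Ψ : TensorSpace d n) (hΨ : Ψ ∈ symSubspace d n) (hnorm : ‖Ψ‖ = 1) :
    ∃ μ : Measure (PureState d), IsProbabilityMeasure μ ∧
      productMixture k μ ∈ coherentStates d k ∧
      traceNorm (partialTrace hkm (ketBra Ψ) - productMixture k μ) ≤
        2 * ((d : ℝ) * (k : ℝ) / (n : ℝ)) := by
  subst hkm
  -- For d = 0 and n > 0 the tensor space is zero and contains no unit vector.
  have hd : 0 < d := by
    rcases Nat.eq_zero_or_pos d with rfl | hd
    · have : IsEmpty (Fin (k + m) → Fin 0) := ⟨fun x => (x ⟨0, hn⟩).elim0⟩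
      have : Ψ = 0 := Subsingleton.elim _ _
      simp [this] at hnorm
    · exact hd
  let e : PureState d := ⟨EuclideanSpace.single ⟨0, hd⟩ 1, by simp⟩
  have hμ := isProbabilityMeasure_deFinettiMeasure e (fun x => Ψ x) hΨ (sum_star_mul_self hnorm)
  exact ⟨_, hμ, productMixture_mem_coherentStates ⟨0, hd⟩ k rfl _,
    traceNorm_partialTrace_sub_productMixture_le hn e hd Ψ hΨ hnorm⟩

end QuantumDeFinetti

end

theorem mainTheorem2 (d n k : ℕ) (hn : 0 < n) (hk : k ≤ n)
    (Ψ : QuantumDeFinetti.TensorSpace d n)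
    (hΨ : Ψ ∈ QuantumDeFinetti.symSubspace d n) (hnorm : ‖Ψ‖ = 1) :
    (∃ σ ∈ QuantumDeFinetti.coherentStates d k,
      QuantumDeFinetti.traceNorm
        (QuantumDeFinetti.partialTrace (Nat.add_sub_of_le hk) (QuantumDeFinetti.ketBra Ψ) - σ)
        ≤ 2 * ((d : ℝ) * (k : ℝ) / (n : ℝ))) ∧
    (∃ m : MeasureTheory.Measure (QuantumDeFinetti.PureState d),
      MeasureTheory.IsProbabilityMeasure m ∧
      QuantumDeFinetti.traceNorm
        (QuantumDeFinetti.partialTrace (Nat.add_sub_of_le hk) (QuantumDeFinetti.ketBra Ψ)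
          - QuantumDeFinetti.productMixture k m)
        ≤ 2 * ((d : ℝ) * (k : ℝ) / (n : ℝ))) := by
  obtain ⟨μ, hμ, hmem, hle⟩ := QuantumDeFinetti.exists_deFinetti_approximation
    (Nat.add_sub_of_le hk) hn Ψ hΨ hnorm
  exact ⟨⟨_, hmem, hle⟩, μ, hμ, hle⟩
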